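/- Let $K$ be a field, $V$ a $K$-vector space, and let $\mathcal A=\{H_1,\dots,H_n\}$ be a central arrangement of $n$ (distinct, linear) hyperplanes in $V$, with defining forms $\alpha_1,\dots,\alpha_n\in V^*$, so that $H_i=\ker\alpha_i$. Let $S=K[x_1,\dots,x_n]$ and let $S_1=\bigoplus_{i=1}^n Kx_i$ be its space of linear forms. The relation space $F(\mathcal A)\subseteq S_1$ is the kernel of the $K$-linear map $S_1\to V^*$, $x_i\mapsto\alpha_i$. For $f\in S$ let $\Lambda(f)$ be the least common multiple of the monomials occurring in $f$ (with $\Lambda(0)=1$), and let $\iota(f)=\Lambda(f)\cdot f(x_1^{-1},\dots,x_n^{-1})\in S$; in particular, for $r=\sum_{i=1}^n a_ix_i$ one has $\iota(r)=\sum_{i:\,a_i\neq0}a_i\prod_{j\neq i,\,a_j\neq 0}x_j$. The Orlik–Terao ideal of $\mathcal A$ is the ideal $I(\mathcal A)=(\iota(r)\mid r\in F(\mathcal A))$ of $S$. For a subset $\mathfrak R\subseteq F(\mathcal A)$ put $J(\mathfrak R)=(\iota(r)\mid r\in\mathfrak R)\subseteq S$, and write $x_{[n]}=x_1\cdots x_n$.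 For an ideal $I$ of $S$ and $g\in S$, $I:g=\{f\in S\mid fg\in I\}$. **Theorem 3.1.** For every subset $\mathfrak R\subseteq F(\mathcal A)$ the following conditions are equivalent: 1. $\mathcal A$ is $\mathfrak R$-generated, i.e. $\mathfrak R$ spans $F(\mathcal A)$ over $K$; 2. $I(\mathcal A)=J(\mathfrak R):x_{[n]}$; 3. $I(\mathcal A)=\sqrt{J(\mathfrak R)}:x_{[n]}$. -/

import Mathlib

open MvPolynomial

noncomputable section

/-- A central arrangement of `n` (pairwise distinct, linear) hyperplanes `H_1, …, H_n` in a vector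
space `V` over a field `K`, with a chosen defining form `α_i ∈ V^*` for each `H_i = ker α_i`. -/
structure CentralArrangement (K V : Type*) [Field K] [AddCommGroup V] [Module K V] (n : ℕ) where
  /-- the defining forms -/
  form : Fin n → Module.Dual K V
  form_ne_zero : ∀ i, form i ≠ 0
  /-- the hyperplanes are pairwise distinct -/
  ker_injective : Function.Injective fun i => LinearMap.ker (form i)

/-- The exponent vector of `Λ(f)`, the least common multiple of the monomials occurring in `f`
(so `Λ(0) = 1`). -/
def lcmExponent {K : Type*} [Field K] {n : ℕ} (f : MvPolynomial (Fin n) K) : Fin n →₀ ℕ :=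
  f.support.sup id

/-- `ι(f) = Λ(f) · f(x_1⁻¹, …, x_n⁻¹)`: every term `c x^m` of `f` is replaced by `c x^{λ - m}`,
where `Λ(f) = x^λ`. (As `m ≤ λ` for each monomial of `f`, no truncation occurs; see
`algebraMap_iota`.) -/
def iota {K : Type*} [Field K] {n : ℕ} (f : MvPolynomial (Fin n) K) : MvPolynomial (Fin n) K :=
  ∑ m ∈ f.support, monomial (lcmExponent f - m) (coeff m f)

/-- The identity `f(x_1⁻¹, …, x_n⁻¹) = ι(f) / Λ(f)` in the field of rational functions, which
determines `ι(f)`. -/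
theorem algebraMap_iota {K : Type*} [Field K] {n : ℕ} (f : MvPolynomial (Fin n) K) :
    aeval (fun i => (algebraMap (MvPolynomial (Fin n) K)
        (FractionRing (MvPolynomial (Fin n) K)) (X i))⁻¹) f =
      algebraMap (MvPolynomial (Fin n) K) (FractionRing (MvPolynomial (Fin n) K)) (iota f) /
      algebraMap (MvPolynomial (Fin n) K) (FractionRing (MvPolynomial (Fin n) K))
        (monomial (lcmExponent f) 1) := by
  have hX : ∀ i : Fin n, algebraMap (MvPolynomial (Fin n) K)
      (FractionRing (MvPolynomial (Fin n) K)) (X i) ≠ 0 := fun i => by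
    simp [X_ne_zero]
  have hmon : ∀ (d : Fin n →₀ ℕ) (c : K), algebraMap (MvPolynomial (Fin n) K)
      (FractionRing (MvPolynomial (Fin n) K)) (monomial d c) =
      algebraMap K (FractionRing (MvPolynomial (Fin n) K)) c * ∏ i, (algebraMap
        (MvPolynomial (Fin n) K) (FractionRing (MvPolynomial (Fin n) K)) (X i)) ^ d i := by
    intro d c
    rw [monomial_eq, Finsupp.prod_fintype _ _ (by simp), map_mul, map_prod,
      IsScalarTower.algebraMap_apply K (MvPolynomial (Fin n) K), algebraMap_eq]
    simp only [map_pow]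
  rw [iota, map_sum, Finset.sum_div, aeval_def, eval₂_eq']
  refine Finset.sum_congr rfl fun m hm => ?_
  have hle : m ≤ lcmExponent f := Finset.le_sup (f := id) hm
  rw [hmon, hmon, map_one, one_mul, mul_div_assoc, ← Finset.prod_div_distrib]
  congr 1
  refine Finset.prod_congr rfl fun i _ => ?_
  rw [Finsupp.tsub_apply, inv_pow, eq_div_iff (pow_ne_zero _ (hX i)), inv_mul_eq_iff_eq_mul₀
    (pow_ne_zero _ (hX i)), ← pow_add, Nat.add_sub_cancel' (hle i)]

/-- The product `x_{[n]} = x_1 ⋯ x_n` of all the variables. -/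
def prodVars (K : Type*) [Field K] (n : ℕ) : MvPolynomial (Fin n) K := ∏ i, X i

/-- `J(R)`: the ideal of `K[x_1, …, x_n]` generated by the polynomials `ι(r)`, `r ∈ R`. -/
def iotaIdeal {K : Type*} [Field K] {n : ℕ} (R : Set (MvPolynomial (Fin n) K)) :
    Ideal (MvPolynomial (Fin n) K) :=
  Ideal.span (iota '' R)

namespace CentralArrangement

variable {K V : Type*} [Field K] [AddCommGroup V] [Module K V] {n : ℕ}

/-- The linear map `f ↦ ∑ i, (coefficient of x_i in f) • α_i`; on the linear forms `S_1` this is the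
map `S_1 → V^*`, `x_i ↦ α_i`. -/
def toDual (A : CentralArrangement K V n) : MvPolynomial (Fin n) K →ₗ[K] Module.Dual K V :=
  ∑ i, (lcoeff K (Finsupp.single i 1)).smulRight (A.form i)

/-- The relation space `F(A)`: the kernel of `S_1 → V^*`, `x_i ↦ α_i`, where `S_1` is the space of
linear forms in `K[x_1, …, x_n]`. -/
def relationSpace (A : CentralArrangement K V n) : Submodule K (MvPolynomial (Fin n) K) :=
  homogeneousSubmodule (Fin n) K 1 ⊓ LinearMap.ker A.toDual

/-- `A` is `R`-generated: the set `R` of relations spans the relation space. -/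
def IsGeneratedBy (A : CentralArrangement K V n) (R : Set (MvPolynomial (Fin n) K)) : Prop :=
  Submodule.span K R = A.relationSpace

/-- The Orlik–Terao ideal `I(A)`, generated by all `ι(r)`, `r ∈ F(A)`. -/
def orlikTeraoIdeal (A : CentralArrangement K V n) : Ideal (MvPolynomial (Fin n) K) :=
  Ideal.span (iota '' (A.relationSpace : Set (MvPolynomial (Fin n) K)))

end CentralArrangement

end

/-!
Let `ψ_b` be the homomorphism `x_i ↦ 1 / b i` attached to nonzero vectors `b 1, …, b n` of a vector
space `W`, with values in the field of fractions of the symmetric algebra of `W`. For a linear form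
`r = ∑ a_i x_i` the element `ψ_b (ι(r))` is a unit times `∑ a_i b_i`, so `ψ_b` kills `ι(r)` exactly
when `r` is a relation among the `b i`
(`reciprocalHom_iota_linForm_eq_zero_iff`).

The main point is that these `ι(r)` generate the kernel of `ψ_b` (`ker_reciprocalHom`). Call a
monomial good if no `b j` is a combination of the `b i` with `i > j` and `x_i` dividing the monomial
(its support contains no broken circuit). A relation violating this condition rewrites a monomial
modulo the `ι(r)` by monomials in which some `x_i` is replaced by `x_j` with `j < i`, so the good
monomials span modulo the `ι(r)` (`monomial_mem_iotaIdeal_sup_restrictSupport`). On the other hand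
`ψ_b` is injective on their span (`IsNBC.sum_ne_zero`, `reciprocalHom_ne_zero`). This goes by
induction on the number of vectors: the coefficient of the highest power of `1 / b a`, for the
largest index `a`, restricted to the hyperplane `b a = 0`, is a relation between good monomials for
the images of the other vectors in the quotient by `b a`.

Hence the Orlik–Terao ideal `I` is prime and contains no variable, so `I : x_[n] = I` and every ideal
below `I` has its radical below `I`. If `R` spans the relations, then `x_[n] * r(x⁻¹)` lies in `J(R)`
for every relation `r`, because it is linear in `r` (`iota_mul_prodVars_mem_iotaIdeal`).
Conversely, taking for `b i` the class of `x_i` modulo the span of `R` gives a homomorphism which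
kills `√J(R)` and no variable; if `x_[n] * ι(r)` lies in `√J(R)`, it kills `ι(r)`, which means that
`r` is in the span of `R` (`mem_span_of_iota_mul_prodVars_mem_radical`).
-/

/-! ### Linear forms and their reciprocals -/

section LinearForms

variable {K : Type*} [Field K] {n : ℕ}

/-- The linear form `∑ i, r i * x_i` with coefficient vector `r`. -/
noncomputable def linForm (r : Fin n → K) : MvPolynomial (Fin n) K :=
  ∑ i, monomial (Finsupp.single i 1) (r i)

theorem coeff_linForm (r : Fin n → K) (i : Fin n) :
    coeff (Finsupp.single i 1) (linForm r) = r i := by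
  simp [linForm, coeff_sum, coeff_monomial, Finsupp.single_left_inj]

theorem exists_of_mem_support_linForm {r : Fin n → K} {m : Fin n →₀ ℕ}
    (hm : m ∈ (linForm r).support) : ∃ i, r i ≠ 0 ∧ m = Finsupp.single i 1 := by
  rw [mem_support_iff, linForm, coeff_sum] at hm
  obtain ⟨i, -, hi⟩ := Finset.exists_ne_zero_of_sum_ne_zero hm
  rw [coeff_monomial] at hi
  split_ifs at hi with h
  · exact ⟨i, hi, h.symm⟩
  · exact absurd rfl hi

theorem isHomogeneous_linForm (r : Fin n → K) : (linForm r).IsHomogeneous 1 :=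
  IsHomogeneous.sum _ _ _ fun _ _ => isHomogeneous_monomial _ (by simp)

theorem linForm_coeff {f : MvPolynomial (Fin n) K} (hf : f.IsHomogeneous 1) :
    linForm (fun i => coeff (Finsupp.single i 1) f) = f := by
  ext m
  by_cases hm : m.degree = 1
  · obtain ⟨i, rfl⟩ : ∃ i, m = Finsupp.single i 1 := by
      have := (Finsupp.range_single_one (σ := Fin n)).ge (show m ∈ {d | d.degree = 1} from hm)
      obtain ⟨i, hi⟩ := this
      exact ⟨i, hi.symm⟩
    exact coeff_linForm _ i
  · rw [hf.coeff_eq_zero hm, (isHomogeneous_linForm _).coeff_eq_zero hm]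

theorem lcmExponent_linForm_apply (r : Fin n → K) [DecidableEq K] (i : Fin n) :
    lcmExponent (linForm r) i = if r i ≠ 0 then 1 else 0 := by
  have hle : lcmExponent (linForm r) ≤
      Finsupp.equivFunOnFinite.symm fun i => if r i ≠ 0 then 1 else 0 := by
    refine Finset.sup_le fun m hm => ?_
    obtain ⟨j, hj, rfl⟩ := exists_of_mem_support_linForm hm
    intro k
    rcases eq_or_ne j k with rfl | h
    · simp [hj]
    · simp [Finsupp.single_eq_of_ne' h]
  refine le_antisymm (hle i) ?_
  split_ifs with h
  · have : Finsupp.single i 1 ≤ lcmExponent (linForm r) :=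
      Finset.le_sup (f := id) (mem_support_iff.2 ((coeff_linForm r i).trans_ne h))
    simpa using this i
  · exact Nat.zero_le _

/-- The polynomial `x_U * r(x_1⁻¹, …, x_n⁻¹)`, for a set `U` of indices containing the support of
the linear form `r`. For `U` equal to the support this is `ι(r)`. -/
noncomputable def clearedForm (U : Finset (Fin n)) (r : Fin n → K) : MvPolynomial (Fin n) K :=
  ∑ i ∈ U, r i • ∏ j ∈ U.erase i, X j

/-- An algebra homomorphism to a field that kills no variable takes
`x_U * r(x⁻¹)` to the value read off from this expression. -/
theorem map_clearedForm {F : Type*} [Field F] [Algebra K F] (φ : MvPolynomial (Fin n) K →ₐ[K] F)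
    (hφ : ∀ i, φ (X i) ≠ 0) (U : Finset (Fin n)) (r : Fin n → K) :
    φ (clearedForm U r) = (∏ i ∈ U, φ (X i)) * ∑ i ∈ U, r i • (φ (X i))⁻¹ := by
  rw [clearedForm, map_sum, Finset.mul_sum]
  refine Finset.sum_congr rfl fun i hi => ?_
  rw [map_smul, map_prod, ← Finset.mul_prod_erase U _ hi, mul_smul_comm]
  congr 1
  field_simp [hφ i]

theorem iota_linForm_mul_prod (U : Finset (Fin n)) (r : Fin n → K) [DecidableEq K]
    (hU : ∀ i, r i ≠ 0 → i ∈ U) :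
    iota (linForm r) * ∏ i ∈ U with r i = 0, X i = clearedForm U r := by
  have hX : ∀ i : Fin n, Algebra.ofId (MvPolynomial (Fin n) K)
      (FractionRing (MvPolynomial (Fin n) K)) (X i) ≠ 0 := fun i => by
    simp [Algebra.ofId_apply, X_ne_zero]
  apply IsFractionRing.injective (MvPolynomial (Fin n) K) (FractionRing (MvPolynomial (Fin n) K))
  have hmon : (monomial (lcmExponent (linForm r)) (1 : K)) =
      ∏ i ∈ U with ¬ r i = 0, X i := by
    rw [monomial_eq, Finsupp.prod_fintype _ _ (by simp), C_1, one_mul, Finset.prod_filter]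
    rw [← Finset.prod_subset (Finset.subset_univ U)]
    · refine Finset.prod_congr rfl fun i _ => ?_
      rw [lcmExponent_linForm_apply]
      split_ifs <;> simp_all
    · intro i _ hi
      have : r i = 0 := by_contra fun h => hi (hU i h)
      rw [lcmExponent_linForm_apply]
      simp [this]
  have h := algebraMap_iota (linForm r)
  rw [hmon, eq_div_iff] at h
  · have h2 := map_clearedForm ((Algebra.ofId (MvPolynomial (Fin n) K)
      (FractionRing (MvPolynomial (Fin n) K))).restrictScalars K) hX U r
    simp only [AlgHom.coe_restrictScalars', Algebra.ofId_apply] at h2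
    rw [map_mul, ← h, h2, mul_assoc, ← map_mul, mul_comm (Finset.prod _ _),
      Finset.prod_filter_mul_prod_filter_not, map_prod, mul_comm]
    congr 1
    rw [linForm, map_sum, Finset.sum_subset (Finset.subset_univ U)]
    · refine Finset.sum_congr rfl fun i _ => ?_
      simp [aeval_monomial, Algebra.smul_def]
    · intro i _ hi
      have : r i = 0 := by_contra fun h => hi (hU i h)
      simp [this]
  · rw [map_prod]
    exact Finset.prod_ne_zero_iff.2 fun i _ => hX i

theorem clearedForm_mem_iotaIdeal {R : Set (MvPolynomial (Fin n) K)} {r : Fin n → K}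
    (U : Finset (Fin n)) (hU : ∀ i, r i ≠ 0 → i ∈ U) (hr : linForm r ∈ R) :
    clearedForm U r ∈ iotaIdeal R := by
  classical
  rw [← iota_linForm_mul_prod U r hU]
  exact Ideal.mul_mem_right _ _ (Ideal.subset_span ⟨_, hr, rfl⟩)

end LinearForms

/-! ### Linear independence of no-broken-circuit monomials -/

theorem SymmetricAlgebra.ι_ne_zero {K W : Type*} [Field K] [AddCommGroup W] [Module K W] {w : W}
    (hw : w ≠ 0) : SymmetricAlgebra.ι K W w ≠ 0 := by
  intro h
  obtain ⟨f, hf⟩ := Module.Projective.exists_dual_ne_zero K hw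
  exact hf (by rw [← SymmetricAlgebra.lift_ι_apply f, h, map_zero])

/-- A set `T` of indices is free of broken circuits, relative to the vectors `b i`, `i ∈ E`, if no
`b j` with `j ∈ E` is a linear combination of the vectors `b i` with `i ∈ T` and `i > j`. -/
def IsNBC (K : Type*) {W ι : Type*} [Field K] [AddCommGroup W] [Module K W] [LinearOrder ι]
    (b : ι → W) (E : Finset ι) (T : Set ι) : Prop :=
  ∀ j ∈ E, b j ∉ Submodule.span K (b '' {i ∈ T | j < i})

/-- Linear independence of the monomials `∏ i ∈ E, (1 / b i) ^ m i` with supports free of broken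
circuits, after multiplication by the common denominator `∏ i ∈ E, b i ^ N`. -/
theorem IsNBC.sum_ne_zero {K ι τ : Type*} [Field K] [LinearOrder ι] (E : Finset ι) :
    ∀ {W : Type*} [AddCommGroup W] [Module K W] (b : ι → W), (∀ i ∈ E, b i ≠ 0) →
    ∀ (N : ℕ) (s : Finset τ) (c : τ → K) (m : τ → ι → ℕ), s.Nonempty → (∀ t ∈ s, c t ≠ 0) →
    (∀ t ∈ s, ∀ u ∈ s, (∀ i ∈ E, m t i = m u i) → t = u) → (∀ t ∈ s, ∀ i ∈ E, m t i ≤ N) →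
    (∀ t ∈ s, IsNBC K b E {i ∈ E | m t i ≠ 0}) →
    ∑ t ∈ s, c t • ∏ i ∈ E, SymmetricAlgebra.ι K W (b i) ^ (N - m t i) ≠ 0 := by
  induction E using Finset.induction_on_max with
  | empty =>
    intro W _ _ b _ N s c m hs hc hinj _ _
    obtain ⟨t, ht⟩ := hs
    obtain rfl : s = {t} := Finset.eq_singleton_iff_unique_mem.2
      ⟨ht, fun u hu => hinj u hu t ht (by simp)⟩
    simpa [Algebra.smul_def] using hc t ht
  | insert a E hE ih =>
    intro W _ _ b hb N s c m hs hc hinj hN hnbc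
    have haE : a ∉ E := fun h => lt_irrefl a (hE a h)
    obtain ⟨t₀, ht₀, hmax⟩ := s.exists_max_image (fun t => m t a) hs
    set k := m t₀ a with hk
    have hkN : k ≤ N := hN t₀ ht₀ a (Finset.mem_insert_self a E)
    set ι' := SymmetricAlgebra.ι K W
    -- the terms of maximal pole order `k` along `b a`
    set s' := s.filter fun t => m t a = k with hs'
    have hs'ne : s'.Nonempty := ⟨t₀, by simp [hs', ht₀, hk]⟩
    have hsub : ∀ t ∈ s', t ∈ s ∧ m t a = k := fun t ht => Finset.mem_filter.1 ht
    have hinj' : ∀ t ∈ s', ∀ u ∈ s', (∀ i ∈ E, m t i = m u i) → t = u := by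
      intro t ht u hu h
      refine hinj t (hsub t ht).1 u (hsub u hu).1 fun i hi => ?_
      rcases Finset.mem_insert.1 hi with rfl | hi
      · rw [(hsub t ht).2, (hsub u hu).2]
      · exact h i hi
    have hN' : ∀ t ∈ s', ∀ i ∈ E, m t i ≤ N := fun t ht i hi =>
      hN t (hsub t ht).1 i (Finset.mem_insert_of_mem hi)
    have hc' : ∀ t ∈ s', c t ≠ 0 := fun t ht => hc t (hsub t ht).1
    have hTT : ∀ t j, {i | i ∈ {i | i ∈ E ∧ m t i ≠ 0} ∧ j < i} ⊆
        {i | i ∈ {i | i ∈ insert a E ∧ m t i ≠ 0} ∧ j < i} := fun t j i hi =>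
      ⟨⟨Finset.mem_insert_of_mem hi.1.1, hi.1.2⟩, hi.2⟩
    have hfac : ∑ t ∈ s, c t • ∏ i ∈ insert a E, ι' (b i) ^ (N - m t i) = ι' (b a) ^ (N - k) *
        ∑ t ∈ s, c t • (ι' (b a) ^ (k - m t a) * ∏ i ∈ E, ι' (b i) ^ (N - m t i)) := by
      rw [Finset.mul_sum]
      refine Finset.sum_congr rfl fun t ht => ?_
      have h1 : N - m t a = (N - k) + (k - m t a) := by
        have := hmax t ht
        omega
      rw [Finset.prod_insert haE, h1, pow_add, mul_smul_comm, mul_assoc]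
    rw [hfac]
    refine mul_ne_zero (pow_ne_zero _ (SymmetricAlgebra.ι_ne_zero
      (hb a (Finset.mem_insert_self a E)))) ?_
    rcases Nat.eq_zero_or_pos k with hk0 | hkpos
    · -- no pole along `b a`: delete `a`
      have hma : ∀ t ∈ s, m t a = k := fun t ht => by
        have := hmax t ht
        omega
      have hss : s' = s := Finset.filter_true_of_mem hma
      rw [hss] at hs'ne hinj' hN' hc'
      have := ih b (fun i hi => hb i (Finset.mem_insert_of_mem hi)) N s c m hs'ne hc' hinj' hN'
        (fun t ht j hj hmem => hnbc t ht j (Finset.mem_insert_of_mem hj)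
          (Submodule.span_mono (Set.image_mono (hTT t j)) hmem))
      rwa [Finset.sum_congr rfl fun t ht => by rw [hma t ht, Nat.sub_self, pow_zero, one_mul]]
    · -- contract `a`: restrict to the hyperplane `b a = 0`
      set L := Submodule.span K {b a}
      let φ : SymmetricAlgebra K W →ₐ[K] SymmetricAlgebra K (W ⧸ L) :=
        SymmetricAlgebra.lift ((SymmetricAlgebra.ι K (W ⧸ L)).comp L.mkQ)
      have hφ : ∀ w, φ (ι' w) = SymmetricAlgebra.ι K (W ⧸ L) (L.mkQ w) := fun w => by
        simp [φ, ι']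
      have hφa : φ (ι' (b a)) = 0 := by
        rw [hφ, Submodule.mkQ_apply,
          (Submodule.Quotient.mk_eq_zero L).2 (Submodule.mem_span_singleton_self _), map_zero]
      have hnbc' : ∀ t ∈ s', IsNBC K (fun i => L.mkQ (b i)) E {i ∈ E | m t i ≠ 0} := by
        intro t ht j hj hmem
        refine hnbc t (hsub t ht).1 j (Finset.mem_insert_of_mem hj) ?_
        have himg : (fun i => L.mkQ (b i)) '' {i | (i ∈ E ∧ m t i ≠ 0) ∧ j < i} =
            L.mkQ '' (b '' {i | (i ∈ E ∧ m t i ≠ 0) ∧ j < i}) := by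
          rw [Set.image_image]
        change L.mkQ (b j) ∈
          Submodule.span K ((fun i => L.mkQ (b i)) '' {i | (i ∈ E ∧ m t i ≠ 0) ∧ j < i}) at hmem
        rw [himg, ← Submodule.map_span, ← Submodule.mem_comap, Submodule.comap_map_mkQ] at hmem
        refine (sup_le ?_ ?_ : L ⊔ _ ≤ _) hmem
        · rw [Submodule.span_le, Set.singleton_subset_iff]
          refine Submodule.subset_span ⟨a, ⟨⟨Finset.mem_insert_self a E, ?_⟩, hE j hj⟩, rfl⟩
          rw [(hsub t ht).2]
          exact hkpos.ne'
        · exact Submodule.span_mono (Set.image_mono (hTT t j))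
      have hb' : ∀ i ∈ E, L.mkQ (b i) ≠ 0 := by
        intro i hi h0
        obtain ⟨t, ht⟩ := hs'ne
        refine hnbc' t ht i hi ?_
        simp only [h0, Submodule.zero_mem]
      have key := ih (fun i => L.mkQ (b i)) hb' N s' c m hs'ne hc' hinj' hN' hnbc'
      intro h0
      apply key
      have h1 := congrArg φ h0
      rw [map_zero, map_sum] at h1
      rw [← h1, hs', Finset.sum_filter]
      refine Finset.sum_congr rfl fun t ht => ?_
      rw [map_smul, map_mul, map_pow, hφa, map_prod]
      split_ifs with htk
      · simp [htk, hφ]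
      · have := hmax t ht
        rw [zero_pow (by omega), zero_mul, smul_zero]

/-! ### The algebra of reciprocals of linear forms -/

section Reciprocals

variable {K W : Type*} [Field K] [AddCommGroup W] [Module K W] {n : ℕ}

/-- The linear forms `∑ i, r i * x_i` with `∑ i, r i • b i = 0`. -/
def linearRelations (K : Type*) {W : Type*} [Field K] [AddCommGroup W] [Module K W] {n : ℕ}
    (b : Fin n → W) : Set (MvPolynomial (Fin n) K) :=
  linForm '' {r | ∑ i, r i • b i = 0}

/-- The homomorphism `x_i ↦ 1 / b i` from the polynomial ring to the field of fractions of the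
symmetric algebra of `W`. -/
noncomputable def reciprocalHom (K : Type*) {W : Type*} [Field K] [AddCommGroup W] [Module K W]
    {n : ℕ} (b : Fin n → W) :
    MvPolynomial (Fin n) K →ₐ[K] FractionRing (SymmetricAlgebra K W) :=
  aeval fun i => (algebraMap (SymmetricAlgebra K W) (FractionRing (SymmetricAlgebra K W))
    (SymmetricAlgebra.ι K W (b i)))⁻¹

theorem algebraMap_smul_fractionRing (c : K) (a : SymmetricAlgebra K W) :
    algebraMap (SymmetricAlgebra K W) (FractionRing (SymmetricAlgebra K W)) (c • a) =
      c • algebraMap (SymmetricAlgebra K W) (FractionRing (SymmetricAlgebra K W)) a :=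
  Algebra.linearMap _ (FractionRing (SymmetricAlgebra K W)) |>.map_smul_of_tower c a

theorem algebraMap_ι_ne_zero {w : W} (hw : w ≠ 0) : algebraMap (SymmetricAlgebra K W)
    (FractionRing (SymmetricAlgebra K W)) (SymmetricAlgebra.ι K W w) ≠ 0 :=
  (map_ne_zero_iff _ (IsFractionRing.injective _ _)).2 (SymmetricAlgebra.ι_ne_zero hw)

theorem reciprocalHom_X_ne_zero {b : Fin n → W} (hb : ∀ i, b i ≠ 0) (i : Fin n) :
    reciprocalHom K b (X i) ≠ 0 := by
  rw [reciprocalHom, aeval_X]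
  exact inv_ne_zero (algebraMap_ι_ne_zero (hb i))

theorem reciprocalHom_iota_linForm_eq_zero_iff {b : Fin n → W} (hb : ∀ i, b i ≠ 0)
    (r : Fin n → K) : reciprocalHom K b (iota (linForm r)) = 0 ↔ ∑ i, r i • b i = 0 := by
  classical
  have hX := reciprocalHom_X_ne_zero (K := K) hb
  have h := congrArg (reciprocalHom K b)
    (iota_linForm_mul_prod Finset.univ r fun i _ => Finset.mem_univ i)
  have hsum : ∑ i, r i • (reciprocalHom K b (X i))⁻¹ = algebraMap (SymmetricAlgebra K W)
      (FractionRing (SymmetricAlgebra K W)) (SymmetricAlgebra.ι K W (∑ i, r i • b i)) := by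
    rw [map_sum, map_sum]
    refine Finset.sum_congr rfl fun i _ => ?_
    rw [reciprocalHom, aeval_X, inv_inv, map_smul, algebraMap_smul_fractionRing]
  rw [map_mul, map_prod, map_clearedForm _ hX, hsum] at h
  constructor
  · intro h0
    rw [h0, zero_mul] at h
    by_contra hne
    exact mul_ne_zero (Finset.prod_ne_zero_iff.2 fun i _ => hX i) (algebraMap_ι_ne_zero hne) h.symm
  · intro h0
    rw [h0, map_zero, map_zero, mul_zero] at h
    exact (mul_eq_zero.1 h).resolve_right (Finset.prod_ne_zero_iff.2 fun i _ => hX i)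

theorem isPrime_ker_reciprocalHom (b : Fin n → W) :
    (RingHom.ker (reciprocalHom K b)).IsPrime :=
  haveI : IsDomain (FractionRing (SymmetricAlgebra K W)) := Field.isDomain
  RingHom.ker_isPrime _

theorem iotaIdeal_linearRelations_le_ker {b : Fin n → W} (hb : ∀ i, b i ≠ 0) :
    iotaIdeal (linearRelations K b) ≤ RingHom.ker (reciprocalHom K b) := by
  refine Ideal.span_le.2 ?_
  rintro _ ⟨_, ⟨r, hr, rfl⟩, rfl⟩
  exact (reciprocalHom_iota_linForm_eq_zero_iff hb r).2 hr

/-- A dependence of `b j` on the vectors `b i`, `i > j`, `m i ≠ 0`, expresses the monomial `x^m`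
modulo `I` by the monomials obtained from it by replacing one factor `x_i` by `x_j`. -/
theorem monomial_sub_sum_mem_iotaIdeal {b : Fin n → W} {m : Fin n →₀ ℕ} {j : Fin n}
    {T : Finset (Fin n)} (hjT : j ∉ T) (hT : ∀ i ∈ T, m i ≠ 0) {l : Fin n → K}
    (hl : ∑ i ∈ T, l i • b i = b j) :
    monomial m 1 - ∑ i ∈ T, l i • monomial (m - Finsupp.single i 1 + Finsupp.single j 1) (1 : K) ∈
      iotaIdeal (linearRelations K b) := by
  classical
  set r : Fin n → K := fun i => if i = j then 1 else if i ∈ T then - l i else 0 with hr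
  have hrj : r j = 1 := by simp [hr]
  have hrT : ∀ i ∈ T, r i = - l i := fun i hi => by
    have : i ≠ j := fun h => hjT (h ▸ hi)
    simp [hr, this, hi]
  have hr0 : ∀ i, r i ≠ 0 → i ∈ insert j T := fun i hi => by
    by_contra h
    rw [Finset.mem_insert, not_or] at h
    exact hi (by simp [hr, h.1, h.2])
  have hrel : linForm r ∈ linearRelations K b := by
    refine ⟨r, ?_, rfl⟩
    change ∑ i, r i • b i = 0
    rw [← Finset.sum_subset (Finset.subset_univ (insert j T)), Finset.sum_insert hjT, hrj,
      Finset.sum_congr rfl fun i hi => by rw [hrT i hi, neg_smul], Finset.sum_neg_distrib, hl,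
      one_smul, add_neg_cancel]
    intro i _ hi
    rw [not_imp_comm.1 (hr0 i) hi, zero_smul]
  set d : Fin n →₀ ℕ := ∑ i ∈ T, Finsupp.single i 1 with hd
  have hprod : ∏ i ∈ T, X i = monomial d (1 : K) := by
    simp [hd, X, monomial_sum_one]
  have hdm : d ≤ m := by
    intro i
    rw [hd, Finsupp.finsetSum_apply]
    by_cases hi : i ∈ T
    · rw [Finset.sum_eq_single_of_mem i hi fun k _ hk => Finsupp.single_eq_of_ne' hk]
      simpa [Nat.one_le_iff_ne_zero] using hT i hi
    · rw [Finset.sum_eq_zero fun k hk =>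
        Finsupp.single_eq_of_ne' (ne_of_mem_of_not_mem hk hi)]
      exact Nat.zero_le _
  have hm : monomial (m - d) (1 : K) * ∏ i ∈ T, X i = monomial m 1 := by
    rw [hprod, monomial_mul, tsub_add_cancel_of_le hdm, one_mul]
  have hterm : ∀ i ∈ T, monomial (m - d) (1 : K) * ∏ k ∈ (insert j T).erase i, X k =
      monomial (m - Finsupp.single i 1 + Finsupp.single j 1) 1 := by
    intro i hi
    have hij : i ≠ j := fun h => hjT (h ▸ hi)
    apply mul_right_cancel₀ (X_ne_zero (R := K) i)
    rw [mul_assoc, Finset.prod_erase_mul _ _ (Finset.mem_insert_of_mem hi),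
      Finset.prod_insert hjT, mul_left_comm, hm, X, X, monomial_mul, monomial_mul]
    have h1 : Finsupp.single i 1 ≤ m := by
      simpa [Finsupp.single_le_iff, Nat.one_le_iff_ne_zero] using hT i hi
    rw [add_right_comm, tsub_add_cancel_of_le h1, add_comm]
  have h := Ideal.mul_mem_left _ (monomial (m - d) (1 : K))
    (clearedForm_mem_iotaIdeal (insert j T) hr0 hrel)
  rw [clearedForm, Finset.sum_insert hjT, Finset.erase_insert hjT, hrj, one_smul, mul_add, hm,
    Finset.mul_sum, Finset.sum_congr rfl fun i hi => by
      rw [hrT i hi, mul_smul_comm, hterm i hi, neg_smul], Finset.sum_neg_distrib,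
    ← sub_eq_add_neg] at h
  exact h

/-- Modulo the ideal `I` of the relations among the `b i`, every monomial is a linear combination of
monomials whose supports are free of broken circuits. -/
theorem monomial_mem_iotaIdeal_sup_restrictSupport (b : Fin n → W) (m : Fin n →₀ ℕ) :
    monomial m (1 : K) ∈ (iotaIdeal (linearRelations K b)).restrictScalars K ⊔
      restrictSupport K {m | IsNBC K b Finset.univ {i | m i ≠ 0}} := by
  classical
  -- the rewriting lowers the weight `∑ i, i * m i`
  induction hw : Finsupp.weight (fun i : Fin n => (i : ℕ)) m using Nat.strong_induction_on
    generalizing m with | _ w ih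
  by_cases hm : IsNBC K b Finset.univ {i | m i ≠ 0}
  · refine Submodule.mem_sup_right ?_
    rw [mem_restrictSupport_iff]
    intro k hk
    rw [Finset.mem_coe] at hk
    rwa [Finset.mem_singleton.1 (support_monomial_subset hk)]
  · simp only [IsNBC, not_forall, not_not] at hm
    obtain ⟨j, -, hj⟩ := hm
    set T : Finset (Fin n) := Finset.univ.filter fun i => m i ≠ 0 ∧ j < i with hTdef
    have hTset : {i | i ∈ {i | m i ≠ 0} ∧ j < i} = (T : Set (Fin n)) := by
      ext i; simp [hTdef]
    rw [hTset] at hj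
    obtain ⟨l, hl⟩ := (Submodule.mem_span_image_finset_iff_exists_fun' K).1 hj
    have hT : ∀ i ∈ T, m i ≠ 0 ∧ j < i := fun i hi => (Finset.mem_filter.1 hi).2
    have h := monomial_sub_sum_mem_iotaIdeal (fun h => lt_irrefl j (hT j h).2)
      (fun i hi => (hT i hi).1) hl
    rw [← sub_add_cancel (monomial m (1 : K)) (∑ i ∈ T, l i • monomial
      (m - Finsupp.single i 1 + Finsupp.single j 1) (1 : K))]
    refine add_mem (Submodule.mem_sup_left h) (sum_mem fun i hi => Submodule.smul_mem _ _ ?_)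
    refine ih _ ?_ _ rfl
    have h1 : Finsupp.single i 1 ≤ m := by
      simpa [Finsupp.single_le_iff, Nat.one_le_iff_ne_zero] using (hT i hi).1
    have h2 := congrArg (Finsupp.weight fun i : Fin n => (i : ℕ)) (tsub_add_cancel_of_le h1)
    have h3 : (j : ℕ) < i := (hT i hi).2
    rw [map_add, hw] at h2
    rw [map_add]
    simp only [Finsupp.weight_single, smul_eq_mul, one_mul] at h2 ⊢
    omega

/-- A nonzero combination of monomials with supports free of broken circuits is not killed by
`x_i ↦ 1 / b i`. -/
theorem reciprocalHom_ne_zero {b : Fin n → W} (hb : ∀ i, b i ≠ 0) {q : MvPolynomial (Fin n) K}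
    (hq : ∀ m ∈ q.support, IsNBC K b Finset.univ {i | m i ≠ 0}) (hq0 : q ≠ 0) :
    reciprocalHom K b q ≠ 0 := by
  intro h
  have key := IsNBC.sum_ne_zero Finset.univ b (fun i _ => hb i) q.totalDegree q.support
    (fun m => coeff m q) (fun m i => m i) (support_nonempty.2 hq0) (fun m hm => mem_support_iff.1 hm)
    (fun m _ m' _ h => Finsupp.ext fun i => h i (Finset.mem_univ i))
    (fun m hm i _ => (monomial_le_degreeOf i hm).trans (degreeOf_le_totalDegree q i))
    (fun m hm => by simpa using hq m hm)
  refine key (IsFractionRing.injective _ (FractionRing (SymmetricAlgebra K W)) ?_)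
  rw [map_zero, ← mul_zero (∏ i, algebraMap (SymmetricAlgebra K W)
    (FractionRing (SymmetricAlgebra K W)) (SymmetricAlgebra.ι K W (b i)) ^ q.totalDegree), ← h,
    reciprocalHom, aeval_def, eval₂_eq', Finset.mul_sum, map_sum]
  refine Finset.sum_congr rfl fun m hm => ?_
  rw [mul_left_comm, ← Finset.prod_mul_distrib, algebraMap_smul_fractionRing, Algebra.smul_def, map_prod]
  congr 1
  refine Finset.prod_congr rfl fun i _ => ?_
  have hy := algebraMap_ι_ne_zero (K := K) (hb i)
  have hle := (monomial_le_degreeOf i hm).trans (degreeOf_le_totalDegree q i)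
  rw [map_pow, inv_pow, pow_sub₀ _ hy hle]

theorem ker_reciprocalHom {b : Fin n → W} (hb : ∀ i, b i ≠ 0) :
    RingHom.ker (reciprocalHom K b) = iotaIdeal (linearRelations K b) := by
  refine le_antisymm (fun f hf => ?_) (iotaIdeal_linearRelations_le_ker hb)
  have hmem : f ∈ (iotaIdeal (linearRelations K b)).restrictScalars K ⊔
      restrictSupport K {m | IsNBC K b Finset.univ {i | m i ≠ 0}} := by
    rw [f.as_sum]
    refine sum_mem fun m _ => ?_
    rw [← mul_one (coeff m f), ← smul_eq_mul, ← smul_monomial]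
    exact Submodule.smul_mem _ _ (monomial_mem_iotaIdeal_sup_restrictSupport b m)
  obtain ⟨p, hp, q, hq, rfl⟩ := Submodule.mem_sup.1 hmem
  have hp0 : reciprocalHom K b p = 0 := iotaIdeal_linearRelations_le_ker hb hp
  rw [RingHom.mem_ker, map_add, hp0, zero_add] at hf
  have hq0 : q = 0 := by
    by_contra h
    exact reciprocalHom_ne_zero hb (fun m hm => (mem_restrictSupport_iff K).1 hq hm) h hf
  rw [hq0, add_zero]
  exact hp

end Reciprocals

/-! ### The Orlik–Terao ideal -/

namespace CentralArrangement

variable {K V : Type*} [Field K] [AddCommGroup V] [Module K V] {n : ℕ}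

theorem linForm_mem_relationSpace_iff (A : CentralArrangement K V n) (r : Fin n → K) :
    linForm r ∈ A.relationSpace ↔ ∑ i, r i • A.form i = 0 := by
  rw [relationSpace, Submodule.mem_inf, mem_homogeneousSubmodule,
    and_iff_right (isHomogeneous_linForm r), LinearMap.mem_ker, toDual]
  simp [LinearMap.sum_apply, coeff_linForm]

theorem coe_relationSpace (A : CentralArrangement K V n) :
    (A.relationSpace : Set (MvPolynomial (Fin n) K)) = linearRelations K A.form := by
  ext f
  constructor
  · intro hf
    have hf1 := linForm_coeff (Submodule.mem_inf.1 hf).1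
    rw [SetLike.mem_coe, ← hf1, linForm_mem_relationSpace_iff] at hf
    exact ⟨_, hf, hf1⟩
  · rintro ⟨r, hr, rfl⟩
    exact (A.linForm_mem_relationSpace_iff r).2 hr

theorem X_notMem_relationSpace (A : CentralArrangement K V n) (i : Fin n) :
    X i ∉ A.relationSpace := by
  intro h
  have h2 := (Submodule.mem_inf.1 h).2
  rw [LinearMap.mem_ker, toDual] at h2
  refine A.form_ne_zero i ?_
  simpa [LinearMap.sum_apply, coeff_X, Finsupp.single_left_inj] using h2

theorem orlikTeraoIdeal_eq_ker (A : CentralArrangement K V n) :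
    A.orlikTeraoIdeal = RingHom.ker (reciprocalHom K A.form) := by
  rw [ker_reciprocalHom A.form_ne_zero, ← coe_relationSpace]
  rfl

theorem isPrime_orlikTeraoIdeal (A : CentralArrangement K V n) : A.orlikTeraoIdeal.IsPrime := by
  rw [orlikTeraoIdeal_eq_ker]
  exact isPrime_ker_reciprocalHom _

theorem reciprocalHom_prodVars_ne_zero {W : Type*} [AddCommGroup W] [Module K W] {b : Fin n → W}
    (hb : ∀ i, b i ≠ 0) : reciprocalHom K b (prodVars K n) ≠ 0 := by
  rw [prodVars, map_prod]
  exact Finset.prod_ne_zero_iff.2 fun i _ => reciprocalHom_X_ne_zero hb i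

theorem mem_orlikTeraoIdeal_of_mul_prodVars_mem (A : CentralArrangement K V n)
    {f : MvPolynomial (Fin n) K} (hf : f * prodVars K n ∈ A.orlikTeraoIdeal) :
    f ∈ A.orlikTeraoIdeal := by
  refine (A.isPrime_orlikTeraoIdeal.mem_or_mem hf).resolve_right ?_
  rw [orlikTeraoIdeal_eq_ker, RingHom.mem_ker]
  exact reciprocalHom_prodVars_ne_zero A.form_ne_zero

/-- `x_[n] * r(x⁻¹)` is linear in `r`, so it lies in `J(R)` for all `r` in the span of `R`, and
`x_[n] * ι(r)` is a multiple of it. -/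
theorem iota_mul_prodVars_mem_iotaIdeal (A : CentralArrangement K V n)
    {R : Set (MvPolynomial (Fin n) K)} (hR : R ⊆ A.relationSpace)
    {f : MvPolynomial (Fin n) K} (hf : f ∈ Submodule.span K R) :
    iota f * prodVars K n ∈ iotaIdeal R := by
  classical
  have hlin : ∀ g ∈ Submodule.span K R, g.IsHomogeneous 1 := fun g hg =>
    (Submodule.mem_inf.1 (Submodule.span_le.2 hR hg)).1
  have hcl : clearedForm Finset.univ (fun i => coeff (Finsupp.single i 1) f) ∈ iotaIdeal R := by
    induction hf using Submodule.span_induction with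
    | mem g hg =>
      refine clearedForm_mem_iotaIdeal _ (fun i _ => Finset.mem_univ i) ?_
      rwa [linForm_coeff (hlin g (Submodule.subset_span hg))]
    | zero => simp [clearedForm]
    | add g h _ _ hg hh => simpa [clearedForm, add_smul, Finset.sum_add_distrib] using add_mem hg hh
    | smul c g _ hg =>
      have := Submodule.smul_of_tower_mem (iotaIdeal R) c hg
      simpa [clearedForm, mul_smul, Finset.smul_sum] using this
  set r : Fin n → K := fun i => coeff (Finsupp.single i 1) f
  have hfr : linForm r = f := linForm_coeff (hlin f hf)
  rw [← iota_linForm_mul_prod Finset.univ r fun i _ => Finset.mem_univ i, hfr] at hcl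
  have hprod : prodVars K n = (∏ i with r i = 0, X i) * ∏ i with ¬ r i = 0, X i := by
    rw [Finset.prod_filter_mul_prod_filter_not, prodVars]
  rw [hprod, ← mul_assoc]
  exact Ideal.mul_mem_right _ _ hcl

/-- The relations lying in `span R` are detected by the homomorphism `x_i ↦ 1 / x̄_i`, where `x̄_i`
is the class of `x_i` modulo `span R`; it kills `√J(R)`, but no variable. -/
theorem mem_span_of_iota_mul_prodVars_mem_radical (A : CentralArrangement K V n)
    {R : Set (MvPolynomial (Fin n) K)} (hR : R ⊆ A.relationSpace)
    {f : MvPolynomial (Fin n) K} (hf : f ∈ A.relationSpace)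
    (hmem : iota f * prodVars K n ∈ (iotaIdeal R).radical) : f ∈ Submodule.span K R := by
  set L := Submodule.span K R
  have hL : L ≤ A.relationSpace := Submodule.span_le.2 hR
  let b : Fin n → MvPolynomial (Fin n) K ⧸ L := fun i => L.mkQ (X i)
  have hb : ∀ i, b i ≠ 0 := fun i h =>
    A.X_notMem_relationSpace i (hL ((Submodule.Quotient.mk_eq_zero L).1 h))
  have hsum : ∀ r : Fin n → K, ∑ i, r i • b i = L.mkQ (linForm r) := fun r => by
    rw [linForm, map_sum]
    refine Finset.sum_congr rfl fun i _ => ?_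
    rw [← map_smul, X, smul_monomial, smul_eq_mul, mul_one]
  have hzero : ∀ g ∈ A.relationSpace, reciprocalHom K b (iota g) = 0 ↔ g ∈ L := by
    intro g hg
    rw [← linForm_coeff (Submodule.mem_inf.1 hg).1, reciprocalHom_iota_linForm_eq_zero_iff hb, hsum,
      Submodule.mkQ_apply, Submodule.Quotient.mk_eq_zero]
  have hJ : iotaIdeal R ≤ RingHom.ker (reciprocalHom K b) := by
    refine Ideal.span_le.2 ?_
    rintro _ ⟨g, hg, rfl⟩
    exact (hzero g (hR hg)).2 (Submodule.subset_span hg)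
  have hker := (isPrime_ker_reciprocalHom b).radical_le_iff.2 hJ hmem
  rw [RingHom.mem_ker, map_mul] at hker
  exact (hzero f hf).1 ((mul_eq_zero.1 hker).resolve_right (reciprocalHom_prodVars_ne_zero hb))

end CentralArrangement

theorem theorem3p1 {K V : Type*} [Field K] [AddCommGroup V] [Module K V] {n : ℕ}
    (A : CentralArrangement K V n) (R : Set (MvPolynomial (Fin n) K))
    (hR : R ⊆ (A.relationSpace : Set (MvPolynomial (Fin n) K))) :
    List.TFAE
      [A.IsGeneratedBy R,
       A.orlikTeraoIdeal = (iotaIdeal R).colon {prodVars K n},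
       A.orlikTeraoIdeal = (iotaIdeal R).radical.colon {prodVars K n}] := by
  have hJI : iotaIdeal R ≤ A.orlikTeraoIdeal := Ideal.span_mono (Set.image_mono hR)
  have hJI' : (iotaIdeal R).radical ≤ A.orlikTeraoIdeal :=
    A.isPrime_orlikTeraoIdeal.radical_le_iff.2 hJI
  tfae_have 1 → 2 := by
    intro h
    refine le_antisymm (Ideal.span_le.2 ?_) fun f hf => ?_
    · rintro _ ⟨f, hf, rfl⟩
      refine Submodule.mem_colon_singleton.2 (A.iota_mul_prodVars_mem_iotaIdeal hR ?_)
      rw [h]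
      exact hf
    · exact A.mem_orlikTeraoIdeal_of_mul_prodVars_mem (hJI (Submodule.mem_colon_singleton.1 hf))
  tfae_have 2 → 3 := by
    intro h
    refine le_antisymm (fun f hf => ?_) fun f hf => ?_
    · rw [h] at hf
      exact Submodule.mem_colon_singleton.2 (Ideal.le_radical (Submodule.mem_colon_singleton.1 hf))
    · exact A.mem_orlikTeraoIdeal_of_mul_prodVars_mem (hJI' (Submodule.mem_colon_singleton.1 hf))
  tfae_have 3 → 1 := by
    intro h
    refine le_antisymm (Submodule.span_le.2 hR) fun f hf => ?_
    refine A.mem_span_of_iota_mul_prodVars_mem_radical hR hf (Submodule.mem_colon_singleton.1 ?_)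
    rw [← h]
    exact Ideal.subset_span ⟨f, hf, rfl⟩
  tfae_finish
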